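/- Conventions. Let $(X,d)$ be a metric space with more than one point that is uniformly perfect: there is $c\in(0,1)$ such that $B(x,R)\setminus B(x,cR)\neq\varnothing$ for all $x\in X$ and all $0<R<|X|$, where $B$ denotes open balls and $|\cdot|$ denotes diameter. A function $\Phi:(0,\Delta)\to\mathbb{R}$ (for some $\Delta>0$) is admissible if it is monotonic, $0<\Phi(\delta)\le\delta$ for all $\delta\in(0,\Delta)$, and $\Phi(\delta)/\delta\to0$ as $\delta\to0^+$. For a non-empty totally bounded $F\subseteq X$, the upper $\Phi$-intermediate dimension $\overline{\dim}^{\Phi}F$ is the infimum of all $s\ge0$ such that for all $\epsilon>0$ there is $\delta_0\in(0,1]$ such that for all $\delta\in(0,\delta_0)$ there is a countable cover $\{U_i\}$ of $F$ with $\Phi(\delta)\le|U_i|\le\delta$ for all $i$ and $\sum_i|U_i|^s\le\epsilon$; the lower $\Phi$-intermediate dimension $\underline{\dim}^{\Phi}F$ is defined in the same way, with "there is $\delta_0\in(0,1]$ such that for all $\delta\in(0,\delta_0)$" replaced by "and all $\delta_0\in(0,1]$ there is $\delta\in(0,\delta_0)$ for which". Let $N_r(E)$ be the least number of open balls of radius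 $r/2$ centred in $E$ that cover $E$. The Assouad dimension $\dim_{\mathrm A}F$ is the infimum of all $a$ for which there is $C>0$ with $N_r(B(x,R)\cap F)\le C(R/r)^{a}$ for all $x\in F$ and $0<r<R$; the lower dimension $\dim_{\mathrm L}F$ is the supremum of all $\lambda$ for which there is $C>0$ with $N_r(B(x,R)\cap F)\ge C(R/r)^{\lambda}$ for all $x\in F$ and $0<r<R\le|F|$. Theorem. Let $\Phi$ and $\Phi_1$ be admissible functions, and let $F\subseteq X$ be non-empty and totally bounded with $\overline{F}$ complete and $0<\dim_{\mathrm A}F<\infty$. Suppose that $0<\overline{\dim}^{\Phi}F<\dim_{\mathrm A}F$ and $\dim_{\mathrm L}F<\overline{\dim}^{\Phi}F$, and let $\eta\in[0,\dim_{\mathrm A}F-\overline{\dim}^{\Phi}F)$. Define \[ \gamma:=\frac{\overline{\dim}^{\Phi}F-\dim_{\mathrm L}F}{\overline{\dim}^{\Phi}F+\eta-\dim_{\mathrm L}F},\qquad \alpha:=\frac{\dim_{\mathrm A}F-\overline{\dim}^{\Phi}F}{\dim_{\mathrm A}F-\overline{\dim}^{\Phi}F-\eta}. \] If $\Phi_1(\delta)\le\bigl(\Phi(\delta^{1/\alpha})\bigr)^{\gamma}$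 for all sufficiently small $\delta>0$, then $\overline{\dim}^{\Phi_1}F\le\overline{\dim}^{\Phi}F+\eta$. The same holds with $\overline{\dim}$ replaced by $\underline{\dim}$ throughout (in the hypotheses, in the range of $\eta$, in the definitions of $\gamma$ and $\alpha$, and in the conclusion). -/

import Mathlib

open Set Filter Topology
open scoped NNReal ENNReal

namespace PhiDim

/-- `B(x, R) \ B(x, cR)` is non-empty for all `x` and all `0 < R < |X|` (open balls; the diameter
`|X|` may be infinite), for some `c` in `(0, 1)`. -/
def UniformlyPerfect (X : Type*) [MetricSpace X] : Prop :=
  ∃ c ∈ Ioo (0 : ℝ) 1, ∀ (x : X) (R : ℝ), 0 < R →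
    ENNReal.ofReal R < Metric.ediam (univ : Set X) →
      (Metric.ball x R \ Metric.ball x (c * R)).Nonempty

/-- Admissible functions `(0, Δ) → ℝ`, represented by functions on `ℝ` whose values outside
`(0, Δ)` are irrelevant. A monotonic function with `0 < Φ δ ≤ δ` is necessarily increasing. -/
def Admissible (Φ : ℝ → ℝ) : Prop :=
  ∃ Δ > 0, MonotoneOn Φ (Ioo 0 Δ) ∧ (∀ δ ∈ Ioo 0 Δ, 0 < Φ δ ∧ Φ δ ≤ δ) ∧
    Tendsto (fun δ => Φ δ / δ) (𝓝[>] 0) (𝓝 0)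

variable {X : Type*} [MetricSpace X]

/-- `N_r(E)`: the least number of open balls of radius `r / 2` with centres in `E` that
cover `E` (`⊤` if there is no finite such cover). -/
noncomputable def coverNum (r : ℝ) (E : Set X) : ℕ∞ :=
  ⨅ (t : Finset X) (_ : (t : Set X) ⊆ E ∧ E ⊆ ⋃ x ∈ t, Metric.ball x (r / 2)), (t.card : ℕ∞)

/-- The Assouad dimension. For a non-empty set only exponents `a ≥ 0` can occur. -/
noncomputable def assouadDim (F : Set X) : ℝ≥0∞ :=
  ⨅ (a : ℝ≥0) (_ : ∃ C : ℝ, 0 < C ∧ ∀ x ∈ F, ∀ r R : ℝ, 0 < r → r < R →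
    (coverNum r (Metric.ball x R ∩ F) : ℝ≥0∞) ≤ ENNReal.ofReal (C * (R / r) ^ (a : ℝ))),
    (a : ℝ≥0∞)

/-- The lower dimension. The exponent `0` always qualifies (with `C = 1`), so that negative
exponents do not contribute to the supremum. -/
noncomputable def lowerDim (F : Set X) : ℝ≥0∞ :=
  ⨆ (a : ℝ≥0) (_ : ∃ C : ℝ, 0 < C ∧ ∀ x ∈ F, ∀ r R : ℝ, 0 < r → r < R →
    ENNReal.ofReal R ≤ Metric.ediam F →
    ENNReal.ofReal (C * (R / r) ^ (a : ℝ)) ≤ (coverNum r (Metric.ball x R ∩ F) : ℝ≥0∞)),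
    (a : ℝ≥0∞)

/-- There is a countable cover `𝒰` of `F` by subsets `U` of the ambient space with
`Φ δ ≤ |U| ≤ δ` for all `U` in `𝒰`, and `∑ |U| ^ s ≤ ε`. -/
def HasCover (Φ : ℝ → ℝ) (F : Set X) (s : ℝ≥0) (ε δ : ℝ) : Prop :=
  ∃ 𝒰 : Set (Set X), 𝒰.Countable ∧ F ⊆ ⋃₀ 𝒰 ∧
    (∀ U ∈ 𝒰, ENNReal.ofReal (Φ δ) ≤ Metric.ediam U ∧ Metric.ediam U ≤ ENNReal.ofReal δ) ∧
    ∑' U : 𝒰, Metric.ediam (U : Set X) ^ (s : ℝ) ≤ ENNReal.ofReal ε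

/-- The upper `Φ`-intermediate dimension. -/
noncomputable def upperPhiDim (Φ : ℝ → ℝ) (F : Set X) : ℝ≥0∞ :=
  ⨅ (s : ℝ≥0) (_ : ∀ ε : ℝ, 0 < ε → ∃ δ₀ ∈ Ioc (0 : ℝ) 1, ∀ δ ∈ Ioo 0 δ₀, HasCover Φ F s ε δ),
    (s : ℝ≥0∞)

/-- The lower `Φ`-intermediate dimension. -/
noncomputable def lowerPhiDim (Φ : ℝ → ℝ) (F : Set X) : ℝ≥0∞ :=
  ⨅ (s : ℝ≥0) (_ : ∀ ε : ℝ, 0 < ε → ∀ δ₀ ∈ Ioc (0 : ℝ) 1, ∃ δ ∈ Ioo 0 δ₀, HasCover Φ F s ε δ),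
    (s : ℝ≥0∞)

/-- The exponent `γ`, for `D` the `Φ`-intermediate dimension and `L` the lower dimension. -/
noncomputable def gammaExp (D L η : ℝ) : ℝ := (D - L) / (D + η - L)

/-- The exponent `α`, for `D` the `Φ`-intermediate dimension and `A` the Assouad dimension. -/
noncomputable def alphaExp (D A η : ℝ) : ℝ := (A - D) / (A - D - η)

end PhiDim

namespace PhiDim

variable {X : Type*} [MetricSpace X]

/-! Write `D`, `L`, `A` for the intermediate dimension with respect to `Φ`, the lower dimension and
the Assouad dimension. Fix `t > D + η`, with `s`, `p`, `a` close to `D`, `L`, `A`. A cheap cover for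
`Φ` at the coarser scale `δ' = δ ^ (1 / α)` has diameters between `φ = Φ δ'` and `δ'`. It is rebuilt
with diameters in `[Φ₁ δ, δ]`, treating its sets differently above and below a threshold `ρ = min (φ
^ γ) (κ * δ)`.

A set of diameter `d ≥ ρ` is thickened by `ρ`; if the result may exceed `δ`, it is cut into about
`(d / δ) ^ a` balls of size `δ`. The cost is at most a constant times `d ^ s * (δ ^ (t - a) * d ^ (a
- s))`, and the bracket is at most 1 because `(A - D) / α = A - D - η` (`exists_cover_of_large`).

Points of `F` not within `ρ` of a set of diameter above `ρ` are covered by balls of size about `ρ`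
around a `4 * ρ`-separated net of `N` points. Near each net point the small sets carry `p`-content
at least of order `ρ ^ p` (`exists_content_ge`), and different points use different sets, so `N * ρ
^ p ≲ ∑ |U| ^ p ≤ φ ^ (p - s) * ∑ |U| ^ s`. The new balls thus cost at most of order `ρ ^ (t - p) *
φ ^ (p - s) * ∑ |U| ^ s`, which is under control because `γ * (D + η - L) = D - L`
(`exists_cover_of_small`).

Uniform perfectness keeps the diameters of the new balls from being too small. -/

/-! ### Separated nets and disjoint subfamilies of a cover -/

lemma exists_separated_net {E : Set X} (hE : TotallyBounded E) {r : ℝ} (hr : 0 < r) :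
    ∃ t : Finset X, (t : Set X) ⊆ E ∧ (t : Set X).Pairwise (fun x y => r < dist x y) ∧
      E ⊆ ⋃ x ∈ t, Metric.ball x (2 * r) := by
  lift r to ℝ≥0 using hr.le
  have hr' : r / 2 ≠ 0 := by
    have : r ≠ 0 := by rintro rfl; simp at hr
    positivity
  obtain ⟨N, -, hNf, hN⟩ := Metric.exists_finite_isCover_of_totallyBounded hr' hE
  have hpack : Metric.packingNumber r E ≠ ⊤ := by
    have h1 := Metric.packingNumber_two_mul_le_externalCoveringNumber (r / 2) E
    rw [mul_div_cancel₀ r two_ne_zero] at h1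
    exact ((h1.trans hN.externalCoveringNumber_le_encard).trans_lt hNf.encard_lt_top).ne
  have hfin : (Metric.maximalSeparatedSet r E).Finite := by
    rw [← Set.encard_ne_top_iff, Metric.encard_maximalSeparatedSet hpack]
    exact hpack
  refine ⟨hfin.toFinset, by simpa using Metric.maximalSeparatedSet_subset, ?_, ?_⟩
  · intro x hx y hy hxy
    have := Metric.isSeparated_maximalSeparatedSet (ε := r) (A := E) (by simpa using hx)
      (by simpa using hy) hxy
    simp only [edist_nndist] at this
    exact_mod_cast this
  · have h := Metric.isCover_maximalSeparatedSet hpack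
    rw [Metric.isCover_iff_subset_iUnion_closedBall] at h
    refine h.trans ?_
    simp only [Set.Finite.mem_toFinset]
    exact iUnion₂_mono fun x _ => Metric.closedBall_subset_ball (by linarith)

lemma sum_tsum_indicator_le {ι β : Type*} (t : Finset ι) (S : ι → Set β) (T : Set β)
    (f : β → ℝ≥0∞) (hdisj : (t : Set ι).PairwiseDisjoint S) (hsub : ∀ i ∈ t, S i ⊆ T) :
    ∑ i ∈ t, ∑' b, (S i).indicator f b ≤ ∑' b, T.indicator f b := by
  rw [← Summable.tsum_finsetSum fun _ _ => ENNReal.summable]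
  refine ENNReal.tsum_le_tsum fun b => ?_
  have h := congrFun (Finset.indicator_biUnion t S (f := f) hdisj) b
  rw [← h]
  exact Set.indicator_le_indicator_of_subset (iUnion₂_subset hsub) (fun _ => zero_le) b

/-- The members of `𝒰` that meet `B`. -/
def meeting (𝒰 : Set (Set X)) (B : Set X) : Set (Set X) := {U ∈ 𝒰 | (U ∩ B).Nonempty}

lemma dist_le_of_mem_of_ediam_le {U : Set X} {d : ℝ} (hd : 0 ≤ d)
    (hU : Metric.ediam U ≤ ENNReal.ofReal d) {x y : X} (hx : x ∈ U) (hy : y ∈ U) :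
    dist x y ≤ d := by
  have := (Metric.edist_le_ediam_of_mem hx hy).trans hU
  rwa [edist_dist, ENNReal.ofReal_le_ofReal_iff hd] at this

lemma disjoint_meeting {𝒰 : Set (Set X)} {x y : X} {ρ d s : ℝ} (hd : 0 ≤ d)
    (h : ∀ U ∈ 𝒰, (U ∩ Metric.ball x ρ).Nonempty → Metric.ediam U ≤ ENNReal.ofReal d)
    (hxy : s < dist x y) (hs : 2 * ρ + d ≤ s) :
    Disjoint (meeting 𝒰 (Metric.ball x ρ)) (meeting 𝒰 (Metric.ball y ρ)) := by
  rw [Set.disjoint_left]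
  rintro U ⟨hU, a, haU, hax⟩ ⟨-, b, hbU, hby⟩
  have h1 := dist_le_of_mem_of_ediam_le hd (h U hU ⟨a, haU, hax⟩) haU hbU
  rw [Metric.mem_ball, dist_comm] at hax
  rw [Metric.mem_ball] at hby
  have h2 := dist_triangle4 x a b y
  linarith

/-! ### Content estimates from the lower dimension -/

lemma exists_separated_finset_of_coverNum_ge {F : Set X} (hF : TotallyBounded F) {l : ℝ≥0}
    {C : ℝ} (hC : ∀ x ∈ F, ∀ r R : ℝ, 0 < r → r < R → ENNReal.ofReal R ≤ Metric.ediam F →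
      ENNReal.ofReal (C * (R / r) ^ (l : ℝ)) ≤ (coverNum r (Metric.ball x R ∩ F) : ℝ≥0∞))
    {θ : ℝ} (hθ : 0 < θ) (hθ' : θ < 1 / 32) {x : X} (hx : x ∈ F) {R : ℝ} (hR : 0 < R)
    (hRF : ENNReal.ofReal R ≤ Metric.ediam F) :
    ∃ t : Finset X, (t : Set X) ⊆ Metric.ball x (R / 2) ∩ F ∧
      (t : Set X).Pairwise (fun x y => 4 * (θ * R) < dist x y) ∧
      ENNReal.ofReal (C * (1 / (32 * θ)) ^ (l : ℝ)) ≤ (t.card : ℝ≥0∞) := by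
  obtain ⟨t, ht, hsep, hcov⟩ := exists_separated_net (E := Metric.ball x (R / 2) ∩ F)
    (hF.subset inter_subset_right) (r := 4 * (θ * R)) (by positivity)
  refine ⟨t, ht, hsep, ?_⟩
  -- `coverNum` at `16 * (θ * R)` counts balls of radius `8 * (θ * R)`, exactly those centred at the
  -- net.
  have h := hC x hx (16 * (θ * R)) (R / 2) (by positivity) (by nlinarith)
    ((ENNReal.ofReal_le_ofReal (by linarith)).trans hRF)
  have e : R / 2 / (16 * (θ * R)) = 1 / (32 * θ) := by field_simp; norm_num
  rw [e] at h
  refine h.trans ?_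
  have h2 : coverNum (16 * (θ * R)) (Metric.ball x (R / 2) ∩ F) ≤ (t.card : ℕ∞) := by
    refine iInf₂_le t ⟨ht, ?_⟩
    convert hcov using 6
    ring
  exact_mod_cast h2

/-- Mass distribution by induction on scale: either one set already has diameter at least `θ * R`,
or the separated points give smaller balls with disjoint families. There are at least `θ ^ (-p)` of
them, which exactly offsets the loss from `R ^ p` to `(θ * R) ^ p`, so the constant does not depend
on the depth `k`. -/
lemma content_ge_aux {F : Set X} {p θ : ℝ} (hp : 0 ≤ p) (hθ : 0 < θ) (hθ' : θ ≤ 1 / 2)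
    (hsep : ∀ x ∈ F, ∀ R : ℝ, 0 < R → ENNReal.ofReal R ≤ Metric.ediam F →
      ∃ t : Finset X, (t : Set X) ⊆ Metric.ball x (R / 2) ∩ F ∧
      (t : Set X).Pairwise (fun x y => 4 * (θ * R) < dist x y) ∧ 1 ≤ θ ^ p * t.card)
    (𝒰 : Set (Set X)) (k : ℕ) :
    ∀ x ∈ F, ∀ R : ℝ, 0 < R → ENNReal.ofReal R ≤ Metric.ediam F →
      F ∩ Metric.ball x R ⊆ ⋃₀ 𝒰 →
      (∀ U ∈ meeting 𝒰 (Metric.ball x R), ENNReal.ofReal (θ ^ k * R) ≤ Metric.ediam U) →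
      ENNReal.ofReal (θ ^ p * R ^ p) ≤
        ∑' U, (meeting 𝒰 (Metric.ball x R)).indicator (fun U => Metric.ediam U ^ p) U := by
  have single : ∀ (x : X) (R : ℝ), 0 < R → ∀ U ∈ meeting 𝒰 (Metric.ball x R),
      ENNReal.ofReal (θ * R) ≤ Metric.ediam U → ENNReal.ofReal (θ ^ p * R ^ p) ≤
        ∑' U, (meeting 𝒰 (Metric.ball x R)).indicator (fun U => Metric.ediam U ^ p) U := by
    intro x R hR U hU hUd
    refine le_trans ?_ (ENNReal.le_tsum U)
    rw [Set.indicator_of_mem hU, ← Real.mul_rpow hθ.le hR.le,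
      ← ENNReal.ofReal_rpow_of_pos (by positivity)]
    exact ENNReal.rpow_le_rpow hUd hp
  induction k with
  | zero =>
    intro x hx R hR _ hcov hU
    obtain ⟨U, hU𝒰, hxU⟩ := hcov ⟨hx, Metric.mem_ball_self hR⟩
    have hm : U ∈ meeting 𝒰 (Metric.ball x R) := ⟨hU𝒰, x, hxU, Metric.mem_ball_self hR⟩
    refine single x R hR U hm (le_trans (ENNReal.ofReal_le_ofReal ?_) (hU U hm))
    rw [pow_zero]
    gcongr
    linarith
  | succ k ih =>
    intro x hx R hR hRF hcov hU
    by_cases hbig : ∃ U ∈ meeting 𝒰 (Metric.ball x R), ENNReal.ofReal (θ * R) ≤ Metric.ediam U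
    · obtain ⟨U, hm, hUd⟩ := hbig
      exact single x R hR U hm hUd
    push Not at hbig
    obtain ⟨t, ht, htsep, hcard⟩ := hsep x hx R hR hRF
    have hθR : θ * R ≤ R / 2 := by nlinarith
    have hball : ∀ y ∈ t, Metric.ball y (θ * R) ⊆ Metric.ball x R := by
      intro y hy
      have h1 : dist y x < R / 2 := (ht hy).1
      exact Metric.ball_subset_ball' (by linarith)
    have hmeet : ∀ y ∈ t, meeting 𝒰 (Metric.ball y (θ * R)) ⊆ meeting 𝒰 (Metric.ball x R) :=
      fun y hy U hU => ⟨hU.1, hU.2.mono (inter_subset_inter_right _ (hball y hy))⟩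
    have hsum := sum_tsum_indicator_le t (fun y => meeting 𝒰 (Metric.ball y (θ * R)))
      (meeting 𝒰 (Metric.ball x R)) (fun U => Metric.ediam U ^ p) ?_ hmeet
    · refine le_trans ?_ hsum
      have hterm : ∀ y ∈ t, ENNReal.ofReal (θ ^ p * (θ * R) ^ p) ≤ ∑' U,
          (meeting 𝒰 (Metric.ball y (θ * R))).indicator (fun U => Metric.ediam U ^ p) U := by
        intro y hy
        refine ih y (ht hy).2 (θ * R) (by positivity)
          ((ENNReal.ofReal_le_ofReal (by linarith)).trans hRF)
          ((inter_subset_inter_right _ (hball y hy)).trans hcov) fun U hm => ?_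
        rw [← mul_assoc, ← pow_succ]
        exact hU U (hmeet y hy hm)
      refine le_trans ?_ (Finset.sum_le_sum hterm)
      rw [Finset.sum_const, nsmul_eq_mul, ← ENNReal.ofReal_natCast,
        ← ENNReal.ofReal_mul (by positivity), Real.mul_rpow hθ.le hR.le]
      refine ENNReal.ofReal_le_ofReal ?_
      have : 0 ≤ θ ^ p * R ^ p := by positivity
      nlinarith
    · intro y hy z hz hyz
      refine disjoint_meeting (d := θ * R) (by positivity) ?_ (htsep hy hz hyz) (by nlinarith)
      exact fun U hU hne => (hbig U (hmeet y hy ⟨hU, hne⟩)).le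

/-- Covers of small balls by sets with diameters bounded below satisfy a content estimate, for any
exponent that is zero or smaller than the lower dimension. -/
lemma exists_content_ge {F : Set X} (hF : TotallyBounded F) {p : ℝ≥0}
    (hp : p = 0 ∨ (p : ℝ≥0∞) < lowerDim F) :
    ∃ c : ℝ, 0 < c ∧ ∀ (𝒰 : Set (Set X)) (m : ℝ), 0 < m →
      ∀ x ∈ F, ∀ R : ℝ, 0 < R → ENNReal.ofReal R ≤ Metric.ediam F →
      F ∩ Metric.ball x R ⊆ ⋃₀ 𝒰 →
      (∀ U ∈ 𝒰, ENNReal.ofReal m ≤ Metric.ediam U) →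
      ENNReal.ofReal (c * R ^ (p : ℝ)) ≤
        ∑' U, (meeting 𝒰 (Metric.ball x R)).indicator (fun U => Metric.ediam U ^ (p : ℝ)) U := by
  suffices h : ∃ θ : ℝ, 0 < θ ∧ θ ≤ 1 / 2 ∧
      ∀ x ∈ F, ∀ R : ℝ, 0 < R → ENNReal.ofReal R ≤ Metric.ediam F →
      ∃ t : Finset X, (t : Set X) ⊆ Metric.ball x (R / 2) ∩ F ∧
      (t : Set X).Pairwise (fun x y => 4 * (θ * R) < dist x y) ∧ 1 ≤ θ ^ (p : ℝ) * t.card by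
    obtain ⟨θ, hθ, hθ', h⟩ := h
    refine ⟨θ ^ (p : ℝ), by positivity, fun 𝒰 m hm x hx R hR hRF hcov hU => ?_⟩
    obtain ⟨k, hk⟩ := exists_pow_lt_of_lt_one (div_pos hm hR) (hθ'.trans_lt (by norm_num))
    refine content_ge_aux p.2 hθ hθ' h 𝒰 k x hx R hR hRF hcov fun U hm => ?_
    refine (ENNReal.ofReal_le_ofReal ?_).trans (hU U hm.1)
    exact ((lt_div_iff₀ hR).1 hk).le
  rcases hp with rfl | hp
  -- For exponent 0 a single point suffices, even if the lower dimension is 0.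
  · refine ⟨1 / 2, by norm_num, le_rfl, fun x hx R hR _ => ⟨{x}, ?_, ?_, ?_⟩⟩
    · simpa using ⟨hR, hx⟩
    · simp
    · simp
  · rw [lowerDim] at hp
    simp only [lt_iSup_iff] at hp
    obtain ⟨l, ⟨C, hC0, hC⟩, hpl⟩ := hp
    have hpl' : (p : ℝ) < l := by exact_mod_cast hpl
    have hlim : Tendsto (fun θ : ℝ => θ ^ ((l : ℝ) - p)) (𝓝[>] 0) (𝓝 0) := by
      have h0 := (Real.continuousAt_rpow_const (0 : ℝ) ((l : ℝ) - p) (Or.inr (by linarith))).tendsto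
      rw [Real.zero_rpow (by linarith)] at h0
      exact h0.mono_left nhdsWithin_le_nhds
    -- Since `p < l`, a small `θ` makes `C * (1 / (32 * θ)) ^ l * θ ^ p` at least 1.
    have hev := hlim.eventually (gt_mem_nhds (show (0 : ℝ) < C / 32 ^ (l : ℝ) by positivity))
    have hev2 : ∀ᶠ θ : ℝ in 𝓝[>] 0, θ ∈ Ioo (0 : ℝ) (1 / 32) := Ioo_mem_nhdsGT (by norm_num)
    obtain ⟨θ, hθ1, hθ0, hθ2⟩ := (hev.and hev2).exists
    refine ⟨θ, hθ0, by linarith, fun x hx R hR hRF => ?_⟩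
    obtain ⟨t, ht, hsep, hcard⟩ :=
      exists_separated_finset_of_coverNum_ge hF hC hθ0 hθ2 hx hR hRF
    refine ⟨t, ht, hsep, ?_⟩
    rw [← ENNReal.ofReal_natCast, ENNReal.ofReal_le_ofReal_iff (by positivity)] at hcard
    refine le_trans ?_ (mul_le_mul_of_nonneg_left hcard (by positivity))
    rw [one_div, Real.inv_rpow (by positivity), Real.mul_rpow (by norm_num) hθ0.le]
    rw [Real.rpow_sub hθ0, div_lt_div_iff₀ (by positivity) (by positivity)] at hθ1
    rw [← div_eq_mul_inv, ← mul_div_assoc, le_div_iff₀ (by positivity)]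
    linarith

/-! ### Replacing the sets of a cover by balls -/

lemma tsum_image_le_card_mul {β γ : Type*} (t : Finset β) (g : β → γ) (f : γ → ℝ≥0∞) (M : ℝ≥0∞)
    (h : ∀ x ∈ t, f (g x) ≤ M) : ∑' V : g '' (t : Set β), f V ≤ t.card * M := by
  classical
  rw [← Finset.coe_image, Finset.tsum_subtype' (t.image g) f]
  calc ∑ V ∈ t.image g, f V ≤ ∑ _V ∈ t.image g, M := by
        refine Finset.sum_le_sum fun V hV => ?_
        obtain ⟨x, hx, rfl⟩ := Finset.mem_image.1 hV
        exact h x hx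
    _ = (t.image g).card * M := by rw [Finset.sum_const, nsmul_eq_mul]
    _ ≤ t.card * M := by
        gcongr
        exact Finset.card_image_le

lemma ediam_ball_bounds {c : ℝ} (hX : ∀ (x : X) (R : ℝ), 0 < R →
      ENNReal.ofReal R < Metric.ediam (univ : Set X) →
      (Metric.ball x R \ Metric.ball x (c * R)).Nonempty)
    (x : X) {R : ℝ} (hR : 0 < R) (hRX : ENNReal.ofReal R < Metric.ediam (univ : Set X)) :
    ENNReal.ofReal (c * R) ≤ Metric.ediam (Metric.ball x R) ∧
      Metric.ediam (Metric.ball x R) ≤ ENNReal.ofReal (2 * R) := by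
  constructor
  · obtain ⟨y, hy, hyc⟩ := hX x R hR hRX
    rw [Metric.mem_ball, not_lt] at hyc
    refine le_trans ?_ (Metric.edist_le_ediam_of_mem hy (Metric.mem_ball_self hR))
    rw [edist_dist]
    exact ENNReal.ofReal_le_ofReal hyc
  · refine Metric.ediam_le fun y hy z hz => ?_
    rw [edist_dist]
    refine ENNReal.ofReal_le_ofReal ?_
    rw [Metric.mem_ball] at hy hz
    have := dist_triangle_right y z x
    linarith

lemma exists_finset_of_coverNum_le {r B : ℝ} {E : Set X}
    (h : (coverNum r E : ℝ≥0∞) ≤ ENNReal.ofReal B) :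
    ∃ t : Finset X, E ⊆ ⋃ x ∈ t, Metric.ball x (r / 2) ∧ (t.card : ℝ≥0∞) ≤ ENNReal.ofReal B := by
  have hlt : coverNum r E < ⊤ := by
    rw [lt_top_iff_ne_top]
    intro htop
    simp [htop] at h
  -- Passing to a strict bound extracts a minimiser from the infimum.
  have hlt' : coverNum r E < coverNum r E + 1 := ENat.lt_add_one_iff hlt.ne |>.2 le_rfl
  conv_lhs at hlt' => rw [coverNum]
  simp only [iInf_lt_iff] at hlt'
  obtain ⟨t, ⟨-, ht⟩, htc⟩ := hlt'
  rw [ENat.lt_add_one_iff hlt.ne] at htc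
  refine ⟨t, ht, le_trans ?_ h⟩
  exact_mod_cast htc

lemma exists_pieces {c : ℝ} (hX : ∀ (x : X) (R : ℝ), 0 < R →
      ENNReal.ofReal R < Metric.ediam (univ : Set X) →
      (Metric.ball x R \ Metric.ball x (c * R)).Nonempty)
    {F : Set X} {a t : ℝ≥0} {C : ℝ} (hC0 : 0 < C) (hC : ∀ x ∈ F, ∀ r R : ℝ, 0 < r → r < R →
      (coverNum r (Metric.ball x R ∩ F) : ℝ≥0∞) ≤ ENNReal.ofReal (C * (R / r) ^ (a : ℝ)))
    {δ d : ℝ} (hδ : 0 < δ) (hδX : ENNReal.ofReal δ ≤ Metric.ediam (univ : Set X))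
    (hd : δ < 4 * d) (W : Set X) (hW : ∀ x ∈ W, ∀ y ∈ W, dist x y ≤ 3 * d) :
    ∃ 𝒱 : Set (Set X), 𝒱.Countable ∧ W ∩ F ⊆ ⋃₀ 𝒱 ∧
      (∀ V ∈ 𝒱, ENNReal.ofReal (c * (δ / 2)) ≤ Metric.ediam V ∧
        Metric.ediam V ≤ ENNReal.ofReal δ) ∧
      ∑' V : 𝒱, Metric.ediam (V : Set X) ^ (t : ℝ) ≤
        ENNReal.ofReal (C * (4 * d / δ) ^ (a : ℝ) * δ ^ (t : ℝ)) := by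
  rcases (W ∩ F).eq_empty_or_nonempty with hE | ⟨x, hxW, hxF⟩
  · exact ⟨∅, countable_empty, by simp [hE], by simp, by simp⟩
  obtain ⟨T, hT, hcard⟩ := exists_finset_of_coverNum_le (hC x hxF δ (4 * d) hδ hd)
  have hb : ∀ y : X, ENNReal.ofReal (c * (δ / 2)) ≤ Metric.ediam (Metric.ball y (δ / 2)) ∧
      Metric.ediam (Metric.ball y (δ / 2)) ≤ ENNReal.ofReal δ := by
    intro y
    have := ediam_ball_bounds hX y (half_pos hδ)
      (((ENNReal.ofReal_lt_ofReal_iff hδ).2 (by linarith)).trans_le hδX)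
    rwa [mul_div_cancel₀ δ two_ne_zero] at this
  refine ⟨(fun y => Metric.ball y (δ / 2)) '' (T : Set X), T.countable_toSet.image _, ?_, ?_, ?_⟩
  · rintro y ⟨hyW, hyF⟩
    have h3 := hW y hyW x hxW
    have hy := hT ⟨show dist y x < 4 * d by linarith, hyF⟩
    simp only [mem_iUnion] at hy
    obtain ⟨z, hz, hyz⟩ := hy
    exact ⟨_, ⟨z, hz, rfl⟩, hyz⟩
  · rintro _ ⟨y, -, rfl⟩
    exact hb y
  · refine (tsum_image_le_card_mul T _ (fun V => Metric.ediam V ^ (t : ℝ))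
      (ENNReal.ofReal δ ^ (t : ℝ)) fun y _ => ENNReal.rpow_le_rpow (hb y).2 t.2).trans ?_
    have : 0 < d := by linarith
    rw [ENNReal.ofReal_rpow_of_pos hδ, ENNReal.ofReal_mul (by positivity)]
    gcongr

/-- Thickening by `ρ ≤ |U|` at most triples the diameter. It lets the new sets also cover the points
near `U`, so that the remaining points see only small sets. -/
lemma exists_cover_of_large {c : ℝ} (hX : ∀ (x : X) (R : ℝ), 0 < R →
      ENNReal.ofReal R < Metric.ediam (univ : Set X) →
      (Metric.ball x R \ Metric.ball x (c * R)).Nonempty)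
    {F : Set X} {a s t : ℝ≥0} {C : ℝ} (hC0 : 0 < C) (hC : ∀ x ∈ F, ∀ r R : ℝ, 0 < r → r < R →
      (coverNum r (Metric.ball x R ∩ F) : ℝ≥0∞) ≤ ENNReal.ofReal (C * (R / r) ^ (a : ℝ)))
    (hsa : s ≤ a) (hst : s ≤ t)
    {δ δ' ρ m : ℝ} (hδ : 0 < δ) (hδX : ENNReal.ofReal δ ≤ Metric.ediam (univ : Set X))
    (hδ' : δ' ≤ 1) (hexp : δ ^ ((t : ℝ) - a) * δ' ^ ((a : ℝ) - s) ≤ 1)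
    (hρ : 0 < ρ) (hmρ : m ≤ ρ) (hmδ : m ≤ c * (δ / 2)) {U : Set X}
    (hUρ : ENNReal.ofReal ρ ≤ Metric.ediam U) (hUδ : Metric.ediam U ≤ ENNReal.ofReal δ') :
    ∃ 𝒱 : Set (Set X), 𝒱.Countable ∧ Metric.thickening ρ U ∩ F ⊆ ⋃₀ 𝒱 ∧
      (∀ V ∈ 𝒱, ENNReal.ofReal m ≤ Metric.ediam V ∧ Metric.ediam V ≤ ENNReal.ofReal δ) ∧
      ∑' V : 𝒱, Metric.ediam (V : Set X) ^ (t : ℝ) ≤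
        ENNReal.ofReal (3 ^ (t : ℝ) + C * 4 ^ (a : ℝ)) * Metric.ediam U ^ (s : ℝ) := by
  obtain ⟨d, hd⟩ : ∃ d : ℝ, d = (Metric.ediam U).toReal := ⟨_, rfl⟩
  have hUtop : Metric.ediam U ≠ ⊤ := (hUδ.trans_lt ENNReal.ofReal_lt_top).ne
  have hUd : Metric.ediam U = ENNReal.ofReal d := by rw [hd, ENNReal.ofReal_toReal hUtop]
  have hd0 : 0 ≤ d := hd ▸ ENNReal.toReal_nonneg
  rw [hUd] at hUρ hUδ ⊢
  rw [ENNReal.ofReal_le_ofReal_iff hd0] at hUρ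
  have hdpos : 0 < d := hρ.trans_le hUρ
  have hdδ' : d ≤ δ' := by
    rcases le_total δ' 0 with h | h
    · rw [ENNReal.ofReal_of_nonpos h, nonpos_iff_eq_zero, ENNReal.ofReal_eq_zero] at hUδ
      linarith
    · exact (ENNReal.ofReal_le_ofReal_iff h).1 hUδ
  have hthick : Metric.ediam (Metric.thickening ρ U) ≤ ENNReal.ofReal (3 * d) := by
    lift ρ to ℝ≥0 using hρ.le
    refine (Metric.ediam_thickening_le ρ).trans ?_
    rw [hUd, ← ENNReal.ofReal_coe_nnreal, ← ENNReal.ofReal_ofNat,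
      ← ENNReal.ofReal_mul (by norm_num), ← ENNReal.ofReal_add hd0 (by positivity)]
    exact ENNReal.ofReal_le_ofReal (by linarith)
  rw [ENNReal.ofReal_rpow_of_pos hdpos]
  by_cases hsmall : 3 * d ≤ δ
  · refine ⟨{Metric.thickening ρ U}, countable_singleton _, ?_, ?_, ?_⟩
    · simp
    · rintro V rfl
      refine ⟨?_, hthick.trans (ENNReal.ofReal_le_ofReal hsmall)⟩
      refine le_trans ?_ (Metric.ediam_mono (Metric.self_subset_thickening hρ U))
      rw [hUd]
      exact ENNReal.ofReal_le_ofReal (hmρ.trans hUρ)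
    · rw [tsum_singleton (f := fun V : Set X => Metric.ediam V ^ (t : ℝ)),
        ← ENNReal.ofReal_mul (by positivity)]
      refine (ENNReal.rpow_le_rpow hthick t.2).trans ?_
      rw [ENNReal.ofReal_rpow_of_pos (by positivity), Real.mul_rpow (by norm_num) hd0]
      refine ENNReal.ofReal_le_ofReal ?_
      have h1 : d ^ (t : ℝ) ≤ d ^ (s : ℝ) :=
        Real.rpow_le_rpow_of_exponent_ge hdpos (hdδ'.trans hδ') (by exact_mod_cast hst)
      exact mul_le_mul (le_add_of_nonneg_right (by positivity)) h1 (by positivity) (by positivity)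
  · push Not at hsmall
    obtain ⟨𝒱, h1, h2, h3, h4⟩ := exists_pieces hX (t := t) hC0 hC hδ hδX (d := d) (by linarith)
      (Metric.thickening ρ U)
      fun x hx y hy => dist_le_of_mem_of_ediam_le (by positivity) hthick hx hy
    refine ⟨𝒱, h1, h2, fun V hV =>
      ⟨(ENNReal.ofReal_le_ofReal hmδ).trans (h3 V hV).1, (h3 V hV).2⟩, h4.trans ?_⟩
    rw [← ENNReal.ofReal_mul (by positivity)]
    refine ENNReal.ofReal_le_ofReal ?_
    have e : C * (4 * d / δ) ^ (a : ℝ) * δ ^ (t : ℝ) =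
        C * 4 ^ (a : ℝ) * (d ^ (s : ℝ) * (δ ^ ((t : ℝ) - a) * d ^ ((a : ℝ) - s))) := by
      rw [Real.div_rpow (by positivity) hδ.le, Real.mul_rpow (by norm_num) hd0,
        Real.rpow_sub hδ, Real.rpow_sub hdpos]
      field_simp
    have h5 : δ ^ ((t : ℝ) - a) * d ^ ((a : ℝ) - s) ≤ 1 := by
      refine le_trans ?_ hexp
      have : (0 : ℝ) ≤ a - s := sub_nonneg.2 (by exact_mod_cast hsa)
      gcongr
    rw [e]
    have h6 : d ^ (s : ℝ) * (δ ^ ((t : ℝ) - a) * d ^ ((a : ℝ) - s)) ≤ d ^ (s : ℝ) :=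
      mul_le_of_le_one_right (by positivity) h5
    have h7 : (0 : ℝ) ≤ 3 ^ (t : ℝ) * d ^ (s : ℝ) := by positivity
    calc _ ≤ C * 4 ^ (a : ℝ) * d ^ (s : ℝ) := by gcongr
      _ ≤ _ := by linarith

/-- The content bound limits the size of a separated net in `E`: the sets of `𝒰` near distinct net
points are distinct, and each net point accounts for a fixed share of `∑ |U| ^ p`. -/
lemma exists_cover_of_small {c : ℝ} (hc : 0 < c) (hc1 : c < 1) (hX : ∀ (x : X) (R : ℝ), 0 < R →
      ENNReal.ofReal R < Metric.ediam (univ : Set X) →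
      (Metric.ball x R \ Metric.ball x (c * R)).Nonempty)
    {F : Set X} (hF : TotallyBounded F) {p s t : ℝ≥0} (hps : p ≤ s) {c₀ : ℝ} (hc₀ : 0 < c₀)
    (hcont : ∀ (𝒰 : Set (Set X)) (m : ℝ), 0 < m →
      ∀ x ∈ F, ∀ R : ℝ, 0 < R → ENNReal.ofReal R ≤ Metric.ediam F →
      F ∩ Metric.ball x R ⊆ ⋃₀ 𝒰 →
      (∀ U ∈ 𝒰, ENNReal.ofReal m ≤ Metric.ediam U) →
      ENNReal.ofReal (c₀ * R ^ (p : ℝ)) ≤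
        ∑' U, (meeting 𝒰 (Metric.ball x R)).indicator (fun U => Metric.ediam U ^ (p : ℝ)) U)
    {δ ρ φ : ℝ} (hδ : 0 < δ) (hδF : ENNReal.ofReal δ ≤ Metric.ediam F)
    (hρ : 0 < ρ) (hρδ : ρ ≤ c / 16 * δ) (hφ : 0 < φ)
    (hexp : ρ ^ ((t : ℝ) - p) ≤ φ ^ ((s : ℝ) - p))
    {𝒰 : Set (Set X)} (hcov : F ⊆ ⋃₀ 𝒰) (h𝒰 : ∀ U ∈ 𝒰, ENNReal.ofReal φ ≤ Metric.ediam U)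
    (h𝒰top : ∀ U ∈ 𝒰, Metric.ediam U ≠ ⊤)
    {E : Set X} (hEF : E ⊆ F) (hE : ∀ x ∈ E, ∀ U ∈ 𝒰, (U ∩ Metric.ball x ρ).Nonempty →
      Metric.ediam U ≤ ENNReal.ofReal ρ) :
    ∃ 𝒱 : Set (Set X), 𝒱.Countable ∧ E ⊆ ⋃₀ 𝒱 ∧
      (∀ V ∈ 𝒱, ENNReal.ofReal ρ ≤ Metric.ediam V ∧ Metric.ediam V ≤ ENNReal.ofReal δ) ∧
      ∑' V : 𝒱, Metric.ediam (V : Set X) ^ (t : ℝ) ≤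
        ENNReal.ofReal ((16 / c) ^ (t : ℝ) / c₀) *
          ∑' U : 𝒰, Metric.ediam (U : Set X) ^ (s : ℝ) := by
  obtain ⟨T, hTE, hsep, hTcov⟩ := exists_separated_net (hF.subset hEF)
    (r := 4 * ρ) (by positivity)
  -- This radius exceeds the covering radius `8 * ρ` of the net, gives diameter at least `8 * ρ` by
  -- uniform perfectness, and at most `16 * ρ / c ≤ δ`.
  have hr : 0 < 8 * ρ / c := by positivity
  have hrδ : 2 * (8 * ρ / c) ≤ δ := by
    rw [show 2 * (8 * ρ / c) = 16 * ρ / c by ring, div_le_iff₀ hc]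
    linarith
  have hρδ' : ρ ≤ δ := by nlinarith
  have hb : ∀ y : X, ENNReal.ofReal ρ ≤ Metric.ediam (Metric.ball y (8 * ρ / c)) ∧
      Metric.ediam (Metric.ball y (8 * ρ / c)) ≤ ENNReal.ofReal (16 / c * ρ) := by
    intro y
    have := ediam_ball_bounds hX y hr (((ENNReal.ofReal_lt_ofReal_iff hδ).2 (by linarith)).trans_le
      (hδF.trans (Metric.ediam_mono (subset_univ F))))
    rw [show c * (8 * ρ / c) = 8 * ρ by field_simp,
      show 2 * (8 * ρ / c) = 16 / c * ρ by ring] at this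
    exact ⟨(ENNReal.ofReal_le_ofReal (by linarith)).trans this.1, this.2⟩
  refine ⟨(fun y => Metric.ball y (8 * ρ / c)) '' (T : Set X), T.countable_toSet.image _,
    ?_, ?_, ?_⟩
  · intro y hy
    have hy' := hTcov hy
    simp only [mem_iUnion] at hy'
    obtain ⟨z, hz, hyz⟩ := hy'
    refine ⟨_, ⟨z, hz, rfl⟩, Metric.ball_subset_ball ?_ hyz⟩
    rw [le_div_iff₀ hc]
    nlinarith
  · rintro _ ⟨y, -, rfl⟩
    refine ⟨(hb y).1, (hb y).2.trans (ENNReal.ofReal_le_ofReal ?_)⟩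
    rwa [show 16 / c * ρ = 2 * (8 * ρ / c) by ring]
  · have hsum := sum_tsum_indicator_le T (fun y => meeting 𝒰 (Metric.ball y ρ)) 𝒰
      (fun U => Metric.ediam U ^ (p : ℝ)) (fun y hy z hz hyz =>
        disjoint_meeting (d := ρ) hρ.le (hE y (hTE hy)) (hsep hy hz hyz) (by linarith))
      fun y _ U hU => hU.1
    have hlow : (T.card : ℝ≥0∞) * ENNReal.ofReal (c₀ * ρ ^ (p : ℝ)) ≤
        ∑' U : 𝒰, Metric.ediam (U : Set X) ^ (p : ℝ) := by
      rw [tsum_subtype 𝒰 fun U => Metric.ediam U ^ (p : ℝ)]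
      refine le_trans ?_ hsum
      rw [← nsmul_eq_mul, ← Finset.sum_const]
      exact Finset.sum_le_sum fun y hy => hcont 𝒰 φ hφ y (hEF (hTE hy)) ρ hρ
        ((ENNReal.ofReal_le_ofReal hρδ').trans hδF) (inter_subset_left.trans hcov) h𝒰
    have hps' : (0 : ℝ) ≤ s - p := sub_nonneg.2 (by exact_mod_cast hps)
    have hφs : ENNReal.ofReal (φ ^ ((s : ℝ) - p)) *
        ∑' U : 𝒰, Metric.ediam (U : Set X) ^ (p : ℝ) ≤
        ∑' U : 𝒰, Metric.ediam (U : Set X) ^ (s : ℝ) := by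
      rw [← ENNReal.tsum_mul_left]
      refine ENNReal.tsum_le_tsum fun U => ?_
      have hU0 : Metric.ediam (U : Set X) ≠ 0 := by
        refine ((ENNReal.ofReal_pos.2 hφ).trans_le (h𝒰 U U.2)).ne'
      rw [← ENNReal.ofReal_rpow_of_pos hφ]
      calc _ ≤ Metric.ediam (U : Set X) ^ ((s : ℝ) - p) * Metric.ediam (U : Set X) ^ (p : ℝ) := by
            gcongr
            exact h𝒰 U U.2
        _ = _ := by
            rw [← ENNReal.rpow_add _ _ hU0 (h𝒰top U U.2), sub_add_cancel]
    refine (tsum_image_le_card_mul T _ (fun V => Metric.ediam V ^ (t : ℝ))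
      (ENNReal.ofReal (16 / c * ρ) ^ (t : ℝ)) fun y _ => ENNReal.rpow_le_rpow (hb y).2 t.2).trans ?_
    calc (T.card : ℝ≥0∞) * ENNReal.ofReal (16 / c * ρ) ^ (t : ℝ)
        ≤ T.card * (ENNReal.ofReal ((16 / c) ^ (t : ℝ) / c₀) *
          (ENNReal.ofReal (φ ^ ((s : ℝ) - p)) * ENNReal.ofReal (c₀ * ρ ^ (p : ℝ)))) := by
          gcongr
          rw [ENNReal.ofReal_rpow_of_pos (by positivity), ← ENNReal.ofReal_mul (by positivity),
            ← ENNReal.ofReal_mul (by positivity), Real.mul_rpow (by positivity) hρ.le]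
          refine ENNReal.ofReal_le_ofReal ?_
          calc (16 / c) ^ (t : ℝ) * ρ ^ (t : ℝ)
              = (16 / c) ^ (t : ℝ) * (ρ ^ ((t : ℝ) - p) * ρ ^ (p : ℝ)) := by
                rw [← Real.rpow_add hρ, sub_add_cancel]
            _ ≤ (16 / c) ^ (t : ℝ) * (φ ^ ((s : ℝ) - p) * ρ ^ (p : ℝ)) := by gcongr
            _ = _ := by field_simp
      _ = ENNReal.ofReal ((16 / c) ^ (t : ℝ) / c₀) * (ENNReal.ofReal (φ ^ ((s : ℝ) - p)) *
          (T.card * ENNReal.ofReal (c₀ * ρ ^ (p : ℝ)))) := by ring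
      _ ≤ _ := by
          gcongr
          refine le_trans ?_ hφs
          gcongr

/-! ### Transferring covers between scales and choosing exponents -/

lemma le_of_forall_nnreal_gt {x y : ℝ≥0∞} (h : ∀ t : ℝ≥0, y < t → x ≤ t) : x ≤ y := by
  by_contra! hlt
  obtain ⟨t, hyt, htx⟩ := ENNReal.lt_iff_exists_nnreal_btwn.1 hlt
  exact (h t hyt).not_gt htx

lemma ediam_pos_of_assouadDim_pos {F : Set X} (h : 0 < assouadDim F) : 0 < Metric.ediam F := by
  by_contra h0
  rw [not_lt, nonpos_iff_eq_zero, Metric.ediam_eq_zero_iff] at h0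
  refine h.not_ge ?_
  rw [assouadDim]
  refine (iInf₂_le (0 : ℝ≥0) ⟨1, one_pos, fun x hx r R hr hrR => ?_⟩).trans (by simp)
  have h1 : coverNum r (Metric.ball x R ∩ F) ≤ (({x} : Finset X).card : ℕ∞) := by
    refine iInf₂_le ({x} : Finset X) ⟨?_, fun y hy => ?_⟩
    · simpa using ⟨hr.trans hrR, hx⟩
    · simp [h0 hy.2 hx, hr]
  simpa using ENat.toENNReal_le.2 h1

/-- The two constructions combined, with constants independent of the scales, of `ε` and of both
functions. Only two inequalities between powers remain to be arranged. -/
lemma exists_transfer (hX : UniformlyPerfect X) {F : Set X} (hF : TotallyBounded F)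
    (hA₀ : 0 < assouadDim F) {p s t a : ℝ≥0} (hp : p = 0 ∨ (p : ℝ≥0∞) < lowerDim F)
    (hps : p ≤ s) (hsa : s ≤ a) (hst : s ≤ t)
    (ha : ∃ C : ℝ, 0 < C ∧ ∀ x ∈ F, ∀ r R : ℝ, 0 < r → r < R →
      (coverNum r (Metric.ball x R ∩ F) : ℝ≥0∞) ≤ ENNReal.ofReal (C * (R / r) ^ (a : ℝ))) :
    ∃ κ > 0, ∃ K > 0, ∃ δ₁ > 0, ∀ (Φ Φ₁ : ℝ → ℝ) (δ δ' ρ ε : ℝ), 0 < δ → δ ≤ δ₁ → δ' ≤ 1 →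
      0 < Φ δ' → 0 < ρ → ρ ≤ κ * δ → Φ₁ δ ≤ ρ →
      ρ ^ ((t : ℝ) - p) ≤ Φ δ' ^ ((s : ℝ) - p) →
      δ ^ ((t : ℝ) - a) * δ' ^ ((a : ℝ) - s) ≤ 1 →
      HasCover Φ F s ε δ' → HasCover Φ₁ F t (K * ε) δ := by
  obtain ⟨c, ⟨hc0, hc1⟩, hX⟩ := hX
  obtain ⟨C, hC0, hC⟩ := ha
  obtain ⟨c₀, hc₀, hcont⟩ := exists_content_ge hF hp
  obtain ⟨δ₁, hδ₁, hδ₁F⟩ := ENNReal.lt_iff_exists_nnreal_btwn.1 (ediam_pos_of_assouadDim_pos hA₀)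
  refine ⟨c / 16, by positivity, 3 ^ (t : ℝ) + C * 4 ^ (a : ℝ) + (16 / c) ^ (t : ℝ) / c₀,
    by positivity, δ₁, by exact_mod_cast hδ₁, ?_⟩
  rintro Φ Φ₁ δ δ' ρ ε hδ hδδ₁ hδ' hφ hρ hρδ hmρ hexp1 hexp2 ⟨𝒰, h𝒰c, hcov, h𝒰, hsum⟩
  have hδF : ENNReal.ofReal δ ≤ Metric.ediam F := by
    refine le_trans ?_ hδ₁F.le
    rw [← ENNReal.ofReal_coe_nnreal]
    exact ENNReal.ofReal_le_ofReal hδδ₁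
  have hlarge : ∀ U : {U ∈ 𝒰 | ENNReal.ofReal ρ ≤ Metric.ediam U}, ∃ 𝒱 : Set (Set X),
      𝒱.Countable ∧ Metric.thickening ρ (U : Set X) ∩ F ⊆ ⋃₀ 𝒱 ∧
      (∀ V ∈ 𝒱, ENNReal.ofReal (Φ₁ δ) ≤ Metric.ediam V ∧ Metric.ediam V ≤ ENNReal.ofReal δ) ∧
      ∑' V : 𝒱, Metric.ediam (V : Set X) ^ (t : ℝ) ≤
        ENNReal.ofReal (3 ^ (t : ℝ) + C * 4 ^ (a : ℝ)) * Metric.ediam (U : Set X) ^ (s : ℝ) :=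
    fun U => exists_cover_of_large hX hC0 hC hsa hst hδ
      (hδF.trans (Metric.ediam_mono (subset_univ F))) hδ' hexp2 hρ hmρ (by nlinarith) U.2.2
      (h𝒰 U U.2.1).2
  choose 𝒱 h𝒱c h𝒱cov h𝒱d h𝒱sum using hlarge
  obtain ⟨𝒲, h𝒲c, h𝒲cov, h𝒲d, h𝒲sum⟩ := exists_cover_of_small hc0 hc1 hX hF (t := t) hps hc₀ hcont hδ
    hδF hρ hρδ hφ hexp1 hcov (fun U hU => (h𝒰 U hU).1)
    (fun U hU => ((h𝒰 U hU).2.trans_lt ENNReal.ofReal_lt_top).ne)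
    (E := {x ∈ F | ∀ U ∈ 𝒰, (U ∩ Metric.ball x ρ).Nonempty →
      Metric.ediam U ≤ ENNReal.ofReal ρ}) (sep_subset _ _) (fun x hx => hx.2)
  have hLc : Countable {U ∈ 𝒰 | ENNReal.ofReal ρ ≤ Metric.ediam U} :=
    (h𝒰c.mono (sep_subset _ _)).to_subtype
  refine ⟨(⋃ U, 𝒱 U) ∪ 𝒲, (countable_iUnion h𝒱c).union h𝒲c, ?_, ?_, ?_⟩
  · intro x hx
    rw [sUnion_union]
    by_cases hxE : ∀ U ∈ 𝒰, (U ∩ Metric.ball x ρ).Nonempty → Metric.ediam U ≤ ENNReal.ofReal ρ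
    · exact Or.inr (h𝒲cov ⟨hx, hxE⟩)
    -- A set of diameter above `ρ` meets the ball around `x`, so `x` lies in its thickening.
    · push Not at hxE
      obtain ⟨U, hU, ⟨y, hyU, hyx⟩, hUρ⟩ := hxE
      obtain ⟨V, hV, hxV⟩ := h𝒱cov ⟨U, hU, hUρ.le⟩
        ⟨Metric.mem_thickening_iff.2 ⟨y, hyU, by rwa [dist_comm]⟩, hx⟩
      exact Or.inl ⟨V, mem_iUnion.2 ⟨_, hV⟩, hxV⟩
  · rintro V (hV | hV)
    · obtain ⟨U, hV⟩ := mem_iUnion.1 hV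
      exact h𝒱d U V hV
    · exact ⟨(ENNReal.ofReal_le_ofReal hmρ).trans (h𝒲d V hV).1, (h𝒲d V hV).2⟩
  · have hsub : ∑' U : {U ∈ 𝒰 | ENNReal.ofReal ρ ≤ Metric.ediam U},
        Metric.ediam (U : Set X) ^ (s : ℝ) ≤ ∑' U : 𝒰, Metric.ediam (U : Set X) ^ (s : ℝ) :=
      ENNReal.tsum_mono_subtype (fun U : Set X => Metric.ediam U ^ (s : ℝ)) (sep_subset _ _)
    refine (ENNReal.tsum_union_le (fun V : Set X => Metric.ediam V ^ (t : ℝ)) _ _).trans ?_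
    refine (add_le_add (ENNReal.tsum_iUnion_le_tsum
      (fun V : Set X => Metric.ediam V ^ (t : ℝ)) 𝒱) h𝒲sum).trans ?_
    refine (add_le_add_left (ENNReal.tsum_le_tsum h𝒱sum) _).trans ?_
    rw [ENNReal.tsum_mul_left]
    have hS := hsub.trans hsum
    rw [ENNReal.ofReal_mul (by positivity), ENNReal.ofReal_add (p := _ + _) (by positivity)
      (by positivity), add_mul]
    exact add_le_add (mul_le_mul_right hS _) (mul_le_mul_right hsum _)

/-- For `s` close to `D` and `t > D + η`, the cover at scale `δ ^ (1 / α)` for the exponent `s` and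
the function `Φ` yields a cover at scale `δ` for the exponent `t` and the function `Φ₁`. -/
lemma exists_eventually_hasCover (hX : UniformlyPerfect X) {F : Set X} (hF : TotallyBounded F)
    (hA₀ : 0 < assouadDim F) (hA : assouadDim F < ⊤)
    {Φ Φ₁ : ℝ → ℝ} (hΦ : Admissible Φ) (hΦ₁ : Admissible Φ₁) {η : ℝ} (hη : 0 ≤ η) {D : ℝ≥0∞}
    (hLD : lowerDim F < D) (hDA : D < assouadDim F)
    (hη' : η < (assouadDim F).toReal - D.toReal)
    (hev : ∀ᶠ δ in 𝓝[>] (0 : ℝ), Φ₁ δ ≤ Φ (δ ^ (1 / alphaExp D.toReal (assouadDim F).toReal η)) ^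
      gammaExp D.toReal (lowerDim F).toReal η)
    {t : ℝ≥0} (ht : D + ENNReal.ofReal η < t) :
    ∃ ε₀ : ℝ≥0, 0 < ε₀ ∧ ∀ s : ℝ≥0, D ≤ s → (s : ℝ≥0∞) < D + ε₀ → ∃ K > 0, ∀ᶠ δ in 𝓝[>] (0 : ℝ),
      ∀ ε : ℝ, HasCover Φ F s ε (δ ^ (1 / alphaExp D.toReal (assouadDim F).toReal η)) →
        HasCover Φ₁ F t (K * ε) δ := by
  obtain ⟨A, hAe⟩ := ENNReal.lt_iff_exists_coe.1 hA |>.imp fun _ h => h.1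
  obtain ⟨d, hDe⟩ := ENNReal.lt_iff_exists_coe.1 (hDA.trans hA) |>.imp fun _ h => h.1
  obtain ⟨L, hLe⟩ := ENNReal.lt_iff_exists_coe.1 (hLD.trans (hDA.trans hA)) |>.imp fun _ h => h.1
  subst hDe
  rw [hAe] at hA₀ hDA hη' hev ⊢
  rw [hLe] at hLD hev
  simp only [ENNReal.coe_toReal] at hη' hev ⊢
  have hLd : (L : ℝ) < d := by exact_mod_cast hLD
  have hdA : (d : ℝ) < A := by exact_mod_cast hDA
  have htr : (d : ℝ) + η < t := by
    lift η to ℝ≥0 using hη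
    rw [ENNReal.ofReal_coe_nnreal] at ht
    exact_mod_cast ht
  obtain ⟨τ, hτ⟩ : ∃ τ : ℝ, τ = t - d - η := ⟨_, rfl⟩
  have hτ0 : 0 < τ := by linarith
  obtain ⟨g, hg⟩ : ∃ g, g = gammaExp d L η := ⟨_, rfl⟩
  obtain ⟨β, hβ⟩ : ∃ β, β = 1 / alphaExp d A η := ⟨_, rfl⟩
  rw [← hg, ← hβ] at hev
  rw [← hβ]
  have hgm : g * (d + η - L) = d - L := by
    rw [hg, gammaExp, div_mul_cancel₀ _ (by linarith)]
  have hβm : β * (A - d) = A - d - η := by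
    rw [hβ, alphaExp, one_div_div, div_mul_cancel₀ _ (by linarith)]
  have hg0 : 0 < g := by
    rw [hg]
    exact div_pos (by linarith) (by linarith)
  have hg1 : g ≤ 1 := by
    rw [hg, gammaExp, div_le_one (by linarith)]
    linarith
  have hβ0 : 0 < β := by
    rw [hβ, alphaExp, one_div_div]
    exact div_pos (by linarith) (by linarith)
  have hβ1 : β ≤ 1 := by
    rw [hβ, alphaExp, one_div_div, div_le_one (by linarith)]
    linarith
  -- The bounds by `g * τ / 2` and `τ` absorb the errors of `s`, `p`, `a` in the two exponent
  -- inequalities; the bound by `A - d` ensures `s ≤ a`.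
  obtain ⟨ε₀, hε₀, hε₀τ, hε₀g, hε₀A⟩ : ∃ ε₀ : ℝ, 0 < ε₀ ∧ ε₀ ≤ τ ∧ 2 * ε₀ ≤ g * τ ∧
      ε₀ ≤ A - d := by
    refine ⟨min τ (min (g * τ / 2) (A - d)), lt_min hτ0 (lt_min (by positivity) (by linarith)),
      min_le_left _ _, ?_, (min_le_right _ _).trans (min_le_right _ _)⟩
    have := (min_le_right τ (min (g * τ / 2) (A - d))).trans (min_le_left _ _)
    linarith
  lift ε₀ to ℝ≥0 using hε₀.le
  refine ⟨ε₀, by exact_mod_cast hε₀, fun s hds hsε => ?_⟩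
  have hds' : (d : ℝ) ≤ s := by exact_mod_cast hds
  have hsε' : (s : ℝ) < d + ε₀ := by exact_mod_cast hsε
  obtain ⟨p, hp, hpL, hLp⟩ : ∃ p : ℝ≥0, (p = 0 ∨ (p : ℝ≥0∞) < lowerDim F) ∧ (p : ℝ) ≤ L ∧
      (L : ℝ) - ε₀ ≤ p := by
    -- If `L = 0` no exponent lies below it and `p = 0` is used; otherwise the subtraction is
    -- truncated at 0.
    rcases eq_or_lt_of_le (zero_le (a := L)) with h | h
    · exact ⟨0, Or.inl rfl, by simp, by simp [← h]⟩
    · refine ⟨L - ε₀, Or.inr ?_, ?_, ?_⟩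
      · rw [hLe]
        exact_mod_cast tsub_lt_self h (by exact_mod_cast hε₀)
      · exact_mod_cast tsub_le_self
      · rw [sub_le_iff_le_add]
        exact_mod_cast le_tsub_add
  obtain ⟨a, ha, hAa, haε⟩ : ∃ a : ℝ≥0, (∃ C : ℝ, 0 < C ∧ ∀ x ∈ F, ∀ r R : ℝ, 0 < r → r < R →
      (coverNum r (Metric.ball x R ∩ F) : ℝ≥0∞) ≤ ENNReal.ofReal (C * (R / r) ^ (a : ℝ))) ∧
      (A : ℝ) ≤ a ∧ (a : ℝ) < A + ε₀ := by
    have h1 : assouadDim F < A + ε₀ := by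
      rw [hAe]
      refine ENNReal.lt_add_right ENNReal.coe_ne_top ?_
      exact_mod_cast hε₀.ne'
    rw [assouadDim] at h1
    simp only [iInf_lt_iff] at h1
    obtain ⟨a, ha, haε⟩ := h1
    have h2 : assouadDim F ≤ a := iInf₂_le a ha
    rw [hAe] at h2
    exact ⟨a, ha, by exact_mod_cast h2, by exact_mod_cast haε⟩
  obtain ⟨κ, hκ, K, hK, δ₁, hδ₁, htrans⟩ := exists_transfer hX hF
    (by rw [hAe]; exact hA₀) (p := p) (s := s) (t := t) (a := a) hp
    (by rw [← NNReal.coe_le_coe]; linarith) (by rw [← NNReal.coe_le_coe]; linarith)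
    (by rw [← NNReal.coe_le_coe]; linarith) ha
  refine ⟨K, hK, ?_⟩
  obtain ⟨Δ, hΔ, -, hΦb, -⟩ := hΦ
  obtain ⟨Δ₁, hΔ₁, -, -, hΦ₁lim⟩ := hΦ₁
  have hβlim : Tendsto (fun δ : ℝ => δ ^ β) (𝓝[>] 0) (𝓝 0) := by
    have h0 := (Real.continuousAt_rpow_const (0 : ℝ) β (Or.inr hβ0.le)).tendsto
    rw [Real.zero_rpow hβ0.ne'] at h0
    exact h0.mono_left nhdsWithin_le_nhds
  filter_upwards [hev, hβlim.eventually (gt_mem_nhds hΔ), hΦ₁lim.eventually (gt_mem_nhds hκ),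
    Ioo_mem_nhdsGT (lt_min hδ₁ one_pos)] with δ h1 h2 h3 ⟨hδ0, hδ4⟩ ε hcov
  have hδδ₁ : δ ≤ δ₁ := hδ4.le.trans (min_le_left _ _)
  have hδ1 : δ ≤ 1 := hδ4.le.trans (min_le_right _ _)
  have hδβ : 0 < δ ^ β := by positivity
  have hδβ1 : δ ^ β ≤ 1 := Real.rpow_le_one hδ0.le hδ1 hβ0.le
  obtain ⟨hφ0, hφ1⟩ := hΦb (δ ^ β) ⟨hδβ, h2⟩
  rw [div_lt_iff₀ hδ0] at h3
  have hp0 : (0 : ℝ) ≤ p := p.2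
  -- The minimum with `κ * δ` leaves room for the balls of size about `ρ`; `Φ₁ δ` stays below it
  -- since `Φ₁ δ / δ` tends to 0.
  refine htrans Φ Φ₁ δ (δ ^ β) (min (Φ (δ ^ β) ^ g) (κ * δ)) ε hδ0 hδδ₁ hδβ1 hφ0
    (lt_min (by positivity) (by positivity)) (min_le_right _ _) (le_min h1 h3.le) ?_ ?_ hcov
  · calc _ ≤ (Φ (δ ^ β) ^ g) ^ ((t : ℝ) - p) :=
        Real.rpow_le_rpow (by positivity) (min_le_left _ _) (by linarith)
      _ = Φ (δ ^ β) ^ (g * ((t : ℝ) - p)) := (Real.rpow_mul hφ0.le _ _).symm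
      _ ≤ _ := Real.rpow_le_rpow_of_exponent_ge hφ0 (hφ1.trans hδβ1) ?_
    -- With `hgm`, the exponent difference `g * (t - p) - (s - p)` is at least `g * τ - 2 * ε₀ + g *
    -- ε₀`.
    have h4 : (1 - g) * (L - ε₀) ≤ (1 - g) * p :=
      mul_le_mul_of_nonneg_left hLp (by linarith)
    have h5 : 0 ≤ g * ε₀ := by positivity
    rw [hτ] at hε₀g
    linarith
  · rw [← Real.rpow_mul hδ0.le, ← Real.rpow_add hδ0]
    refine Real.rpow_le_one hδ0.le hδ1 ?_
    -- With `hβm`, the total exponent of `δ` is at least `τ - ε₀`.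
    have h4 : (1 - β) * a ≤ (1 - β) * (A + ε₀) :=
      mul_le_mul_of_nonneg_left haε.le (by linarith)
    have h5 : β * s ≤ β * (d + ε₀) := mul_le_mul_of_nonneg_left hsε'.le hβ0.le
    linarith

lemma alphaExp_pos {D A η : ℝ} (hη : 0 ≤ η) (h : η < A - D) : 0 < alphaExp D A η :=
  div_pos (by linarith) (by linarith)

end PhiDim

/-! ### The main theorem, for both dimensions -/

theorem mainTheorem6 {X : Type*} [MetricSpace X] [Nontrivial X]
    (hX : PhiDim.UniformlyPerfect X)
    (F : Set X) (hne : F.Nonempty) (hFtb : TotallyBounded F) (hFc : IsComplete (closure F))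
    (hA₀ : 0 < PhiDim.assouadDim F) (hA : PhiDim.assouadDim F < ⊤)
    (Φ Φ₁ : ℝ → ℝ) (hΦ : PhiDim.Admissible Φ) (hΦ₁ : PhiDim.Admissible Φ₁)
    (η : ℝ) (hη : 0 ≤ η) :
    (0 < PhiDim.upperPhiDim Φ F → PhiDim.lowerDim F < PhiDim.upperPhiDim Φ F →
      PhiDim.upperPhiDim Φ F < PhiDim.assouadDim F →
      η < (PhiDim.assouadDim F).toReal - (PhiDim.upperPhiDim Φ F).toReal →
      (∀ᶠ δ in 𝓝[>] (0 : ℝ),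
        Φ₁ δ ≤ Φ (δ ^ (1 / PhiDim.alphaExp (PhiDim.upperPhiDim Φ F).toReal
            (PhiDim.assouadDim F).toReal η)) ^
          PhiDim.gammaExp (PhiDim.upperPhiDim Φ F).toReal (PhiDim.lowerDim F).toReal η) →
      PhiDim.upperPhiDim Φ₁ F ≤ PhiDim.upperPhiDim Φ F + ENNReal.ofReal η) ∧
    (0 < PhiDim.lowerPhiDim Φ F → PhiDim.lowerDim F < PhiDim.lowerPhiDim Φ F →
      PhiDim.lowerPhiDim Φ F < PhiDim.assouadDim F →
      η < (PhiDim.assouadDim F).toReal - (PhiDim.lowerPhiDim Φ F).toReal →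
      (∀ᶠ δ in 𝓝[>] (0 : ℝ),
        Φ₁ δ ≤ Φ (δ ^ (1 / PhiDim.alphaExp (PhiDim.lowerPhiDim Φ F).toReal
            (PhiDim.assouadDim F).toReal η)) ^
          PhiDim.gammaExp (PhiDim.lowerPhiDim Φ F).toReal (PhiDim.lowerDim F).toReal η) →
      PhiDim.lowerPhiDim Φ₁ F ≤ PhiDim.lowerPhiDim Φ F + ENNReal.ofReal η) := by
  constructor
  · intro _ hLD hDA hη' hev
    refine PhiDim.le_of_forall_nnreal_gt fun t ht => ?_
    obtain ⟨ε₀, hε₀, hs⟩ := PhiDim.exists_eventually_hasCover hX hFtb hA₀ hA hΦ hΦ₁ hη hLD hDA hη'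
      hev ht
    have hlt : PhiDim.upperPhiDim Φ F < PhiDim.upperPhiDim Φ F + ε₀ :=
      ENNReal.lt_add_right (hDA.trans hA).ne (by exact_mod_cast hε₀.ne')
    conv_lhs at hlt => rw [PhiDim.upperPhiDim]
    simp only [iInf_lt_iff] at hlt
    obtain ⟨s, hsc, hsε⟩ := hlt
    obtain ⟨K, hK, hev'⟩ := hs s (iInf₂_le s hsc) hsε
    refine iInf₂_le t fun ε hε => ?_
    obtain ⟨δ₀, ⟨hδ₀, hδ₀1⟩, hδ₀c⟩ := hsc (ε / K) (by positivity)
    have hα := PhiDim.alphaExp_pos hη hη'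
    set α := PhiDim.alphaExp (PhiDim.upperPhiDim Φ F).toReal (PhiDim.assouadDim F).toReal η
    obtain ⟨δ₁, hδ₁, hδ₁c⟩ := mem_nhdsGT_iff_exists_Ioo_subset.1 hev'
    -- `δ < δ₀ ^ α` is what places `δ ^ (1 / α)` below `δ₀`.
    refine ⟨min 1 (min δ₁ (δ₀ ^ α)), ⟨lt_min one_pos (lt_min hδ₁ (by positivity)),
      min_le_left _ _⟩, fun δ hδ => ?_⟩
    obtain ⟨hδ0, hδm⟩ := hδ
    simp only [lt_min_iff] at hδm
    have h := hδ₁c ⟨hδ0, hδm.2.1⟩ (ε / K) (hδ₀c _ ⟨by positivity, ?_⟩)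
    · rwa [mul_div_cancel₀ _ hK.ne'] at h
    · have := Real.rpow_lt_rpow hδ0.le hδm.2.2 (one_div_pos.2 hα)
      rwa [← Real.rpow_mul hδ₀.le, mul_one_div_cancel hα.ne', Real.rpow_one] at this
  · intro _ hLD hDA hη' hev
    refine PhiDim.le_of_forall_nnreal_gt fun t ht => ?_
    obtain ⟨ε₀, hε₀, hs⟩ := PhiDim.exists_eventually_hasCover hX hFtb hA₀ hA hΦ hΦ₁ hη hLD hDA hη'
      hev ht
    have hlt : PhiDim.lowerPhiDim Φ F < PhiDim.lowerPhiDim Φ F + ε₀ :=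
      ENNReal.lt_add_right (hDA.trans hA).ne (by exact_mod_cast hε₀.ne')
    conv_lhs at hlt => rw [PhiDim.lowerPhiDim]
    simp only [iInf_lt_iff] at hlt
    obtain ⟨s, hsc, hsε⟩ := hlt
    obtain ⟨K, hK, hev'⟩ := hs s (iInf₂_le s hsc) hsε
    refine iInf₂_le t fun ε hε δ₀ hδ₀ => ?_
    have hα := PhiDim.alphaExp_pos hη hη'
    set α := PhiDim.alphaExp (PhiDim.lowerPhiDim Φ F).toReal (PhiDim.assouadDim F).toReal η
    obtain ⟨δ₁, hδ₁, hδ₁c⟩ := mem_nhdsGT_iff_exists_Ioo_subset.1 hev'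
    have hm : 0 < min δ₀ δ₁ := lt_min hδ₀.1 hδ₁
    -- Here the good coarse scale `δ'` is given first, and the fine scale is defined from it as `δ'
    -- ^ α`.
    obtain ⟨δ', ⟨hδ'0, hδ'm⟩, hδ'c⟩ := hsc (ε / K) (by positivity)
      (min 1 (min δ₀ δ₁ ^ (1 / α))) ⟨lt_min one_pos (by positivity), min_le_left _ _⟩
    have hlt' : δ' ^ α < min δ₀ δ₁ := by
      have := Real.rpow_lt_rpow hδ'0.le (hδ'm.trans_le (min_le_right _ _)) hα
      rwa [← Real.rpow_mul hm.le, one_div_mul_cancel hα.ne', Real.rpow_one] at this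
    rw [lt_min_iff] at hlt'
    refine ⟨δ' ^ α, ⟨by positivity, hlt'.1⟩, ?_⟩
    have h := hδ₁c ⟨by positivity, hlt'.2⟩ (ε / K) ?_
    · rwa [mul_div_cancel₀ _ hK.ne'] at h
    · rwa [← Real.rpow_mul hδ'0.le, mul_one_div_cancel hα.ne', Real.rpow_one]
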